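/- Let $K$ be a field of characteristic other than $2$ and let $G$ be a Chevalley group of classical type over $K$ of rank $n$: $SL_{n+1}$ (type $A_n$, $n\ge 1$), $SO_{2n+1}$ (type $B_n$, $n\ge 1$), $Sp_{2n}$ (type $C_n$, $n\ge 1$) or $SO_{2n}$ (type $D_n$, $n\ge 2$). Let $U$ be the group of upper triangular unipotent elements of $G$, where, for types $B$, $C$, $D$, $G\subset GL_N(K)$ is defined by the bilinear form (symmetric in types $B$, $D$, alternating in type $C$) with $\langle e_i,e_{N+1-i}\rangle=1$ for $1\le i\le N/2$, $\pm1$ for the other $i$, and $\langle e_i,e_j\rangle=0$ for $i+j\ne N+1$. Let $\alpha_1,\dots,\alpha_n$ be the simple roots and let $U_{\alpha_i}=\{\varepsilon_i(c):c\in K\}\subset U$ be the root subgroups attached to them. With $E_{ij}$ the matrix units, these are given by: * type $A_n$: $\varepsilon_i(c)=1+cE_{i,i+1}$; * type $B_n$: $\varepsilon_i(c)=1+c(E_{i,i+1}-E_{2n+1-i,2n+2-i})$ for $i<n$ and $\varepsilon_n(c)=1+c(E_{n,n+1}-E_{n+1,n+2})-\frac{c^2}{2}E_{n,n+2}$; *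 type $C_n$: $\varepsilon_i(c)=1+c(E_{i,i+1}-E_{2n-i,2n+1-i})$ for $i<n$ and $\varepsilon_n(c)=1+2cE_{n,n+1}$; * type $D_n$: $\varepsilon_i(c)=1+c(E_{i,i+1}-E_{2n-i,2n+1-i})$ for $i<n$ and $\varepsilon_n(c)=1+c(E_{n-1,n+1}-E_{n,n+2})$. Let $\tilde U$ be the group generated by $\tilde\Sigma=\{\tilde e_1,\dots,\tilde e_n,\tilde e'_1,\dots,\tilde e'_n\}$ subject only to the relations $$[\tilde e_i,\tilde e_j]=[\tilde e'_i,\tilde e_j]=[\tilde e_i,\tilde e'_j]=[\tilde e'_i,\tilde e'_j]=1$$ for each pair $i,j$ (including $i=j$) such that $U_{\alpha_i}$ and $U_{\alpha_j}$ commute with each other. For $m\ge 0$ let $v_{\tilde U,\tilde\Sigma}(m)$ be the number of elements of $\tilde U$ expressible as a product of exactly $m$ elements of $\tilde\Sigma$ (inverses of the generators are not used). Then $U_{\alpha_i}$ and $U_{\alpha_j}$ commute with each other if and only if the vertices $i$ and $j$ of the Dynkin diagram of $G$ are not joined by an edge (so the relations of $\tilde U$ say exactly that generators whose vertices are not adjacent,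 or are equal, commute), and $$v_{\tilde U,\tilde\Sigma}(m)\le 2^{n+2}(4+2\sqrt3)^m\qquad\text{for all } m\ge 0.$$ -/

import Mathlib

/-! ### Words in a generating set -/

/-- The elements of a group `G` that can be written as a word of length exactly `m` in the elements
of `S` (no inverses are used, unless they lie in `S`). -/
def wordSet {G : Type*} [Group G] (S : Set G) (m : ℕ) : Set G :=
  {g | ∃ w : List G, w.length = m ∧ (∀ s ∈ w, s ∈ S) ∧ w.prod = g}

/-- The counting below is honest: for a finite `S` the set that is counted is finite. -/
theorem wordSet_finite {G : Type*} [Group G] {S : Set G} (hS : S.Finite) (m : ℕ) :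
    (wordSet S m).Finite := by
  have : Finite S := hS
  refine ((List.finite_length_eq S m).image
    (fun l : List S => (l.map Subtype.val).prod)).subset ?_
  rintro g ⟨w, hw, hS', rfl⟩
  refine ⟨w.attach.map fun x => ⟨x.1, hS' x.1 x.2⟩, ?_, ?_⟩
  · simpa using hw
  · simp [List.map_map, Function.comp_def]

/-- `v_{G,S}(m)`: the number of elements of `G` expressible as a word of length exactly `m` in the
elements of `S`. -/
noncomputable def wordGrowth {G : Type*} [Group G] (S : Set G) (m : ℕ) : ℕ :=
  (wordSet S m).ncard

/-! ### Classical types: simple root subgroups and Dynkin diagrams -/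

/-- The four families of classical types. -/
inductive ClassicalType where
  | A
  | B
  | C
  | D

namespace ClassicalType

/-- The ranks that occur: `A_n`, `B_n`, `C_n` for `n ≥ 1`, and `D_n` for `n ≥ 2`
(`SO_2` is a torus and has no roots). -/
def IsRank : ClassicalType → ℕ → Prop
  | D, n => 2 ≤ n
  | _, n => 1 ≤ n

/-- The size of the matrices: the group is `SL_{n+1}`, `SO_{2n+1}`, `Sp_{2n}` or `SO_{2n}`. -/
abbrev dim : ClassicalType → ℕ → ℕ
  | A, n => n + 1
  | B, n => 2 * n + 1
  | C, n => 2 * n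
  | D, n => 2 * n

/-- The `N × N` matrix unit `E_{ij}`, with rows and columns numbered `1, …, N`. -/
def unitMatrix (K : Type*) [Field K] (N i j : ℕ) : Matrix (Fin N) (Fin N) K :=
  Matrix.of fun a b => if a.val + 1 = i ∧ b.val + 1 = j then 1 else 0

/-- The element `ε_k(c)` of the root subgroup of the `k`-th simple root (`1 ≤ k ≤ n`), in the upper
triangular realization of the classical group that preserves the bilinear form pairing the basis
vectors `i` and `N + 1 - i` (types `B`, `C`, `D`). -/
def epsilon (X : ClassicalType) (n : ℕ) (K : Type*) [Field K] (k : ℕ) (c : K) :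
    Matrix (Fin (X.dim n)) (Fin (X.dim n)) K :=
  match X with
  | A =>
    let E := unitMatrix K (dim A n)
    1 + c • E k (k + 1)
  | B =>
    let E := unitMatrix K (dim B n)
    if k < n then 1 + c • (E k (k + 1) - E (2 * n + 1 - k) (2 * n + 2 - k))
    else 1 + c • (E n (n + 1) - E (n + 1) (n + 2)) - (c ^ 2 / 2) • E n (n + 2)
  | C =>
    let E := unitMatrix K (dim C n)
    if k < n then 1 + c • (E k (k + 1) - E (2 * n - k) (2 * n + 1 - k))
    else 1 + c • (E n (n + 1) + E n (n + 1))
  | D =>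
    let E := unitMatrix K (dim D n)
    if k < n then 1 + c • (E k (k + 1) - E (2 * n - k) (2 * n + 1 - k))
    else 1 + c • (E (n - 1) (n + 1) - E n (n + 2))

/-- The root subgroup `{ε_i(c) : c ∈ K}` of the simple root `α_i`, as a set of matrices. The simple
roots are indexed by `Fin n`, so that `i : Fin n` stands for the root number `i + 1`. -/
def simpleRootSubgroup (X : ClassicalType) (n : ℕ) (K : Type*) [Field K] (i : Fin n) :
    Set (Matrix (Fin (X.dim n)) (Fin (X.dim n)) K) :=
  Set.range (X.epsilon n K (i.val + 1))

/-- The root subgroups of the simple roots `α_i` and `α_j` commute with each other. -/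
def RootSubgroupsCommute (X : ClassicalType) (n : ℕ) (K : Type*) [Field K] (i j : Fin n) : Prop :=
  ∀ x ∈ X.simpleRootSubgroup n K i, ∀ y ∈ X.simpleRootSubgroup n K j, Commute x y

/-- The Cartan matrix of the given type and rank. -/
def cartan : ClassicalType → (n : ℕ) → Matrix (Fin n) (Fin n) ℤ
  | A, n => CartanMatrix.A n
  | B, n => CartanMatrix.B n
  | C, n => CartanMatrix.C n
  | D, n => CartanMatrix.D n

/-- The graph underlying the Dynkin diagram: distinct simple roots are joined by an edge (single or
multiple) when the corresponding entry of the Cartan matrix is nonzero. -/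
def dynkinGraph (X : ClassicalType) (n : ℕ) : SimpleGraph (Fin n) :=
  SimpleGraph.fromRel fun i j => X.cartan n i j ≠ 0

end ClassicalType

/-! ### The group `Ũ` -/

/-- The generators `e_i` (`Sum.inl i`) and `e'_i` (`Sum.inr i`) of `Ũ`. -/
abbrev TildeGen (n : ℕ) : Type := Fin n ⊕ Fin n

/-- The index `i` of the generator `e_i` or `e'_i`. -/
def TildeGen.index {n : ℕ} : TildeGen n → Fin n := Sum.elim id id

/-- The defining relations: for each pair `i`, `j` (`i = j` included) such that the root subgroups
of `α_i` and `α_j` commute with each other, the four commutators of `e_i`, `e'_i` with `e_j`, `e'_j`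
are trivial. -/
def tildeRels (X : ClassicalType) (n : ℕ) (K : Type*) [Field K] : Set (FreeGroup (TildeGen n)) :=
  {r | ∃ s t : TildeGen n, X.RootSubgroupsCommute n K s.index t.index ∧
    r = FreeGroup.of s * FreeGroup.of t * (FreeGroup.of s)⁻¹ * (FreeGroup.of t)⁻¹}

/-- The group `Ũ` given by these generators and relations. -/
abbrev TildeU (X : ClassicalType) (n : ℕ) (K : Type*) [Field K] : Type :=
  PresentedGroup (tildeRels X n K)

/-- The generating set `Σ̃ = {e_1, …, e_n, e'_1, …, e'_n}` of `Ũ`. -/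
def tildeSigma (X : ClassicalType) (n : ℕ) (K : Type*) [Field K] : Set (TildeU X n K) :=
  Set.range (PresentedGroup.of (rels := tildeRels X n K))

set_option linter.unusedSimpArgs false

/-! ### Adjacency in the Dynkin diagrams -/

namespace ClassicalType

/-! The equivalence with non-adjacency is a computation with matrix units. For the growth bound,
only the commutations between generators matter. Cartier–Foata: the growth series of a monoid given
by commutations is the inverse of its clique polynomial, here `cliqueSum`, evaluated at `-t`. Only
an inequality is needed (`wordGrowth_range_mul_le`): if all clique sums at `t ≥ 0` are nonnegative,
then `v(m) * t ^ m` times the full clique sum is at most 1.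

Cliques of commuting generators lie over independent sets of the Dynkin diagram. The generators over
one vertex are twins, so the clique sum is an independence polynomial in which a vertex with `k ≤ 2`
generators has weight `1 - (1 - t) ^ k`. At `t = 1 - √3 / 2 = 1 / (4 + 2√3)` these weights are at
most 1/4. On a path, deleting the end vertex gives `P (k + 1) = P k - w k * P (k - 1)`; 1/4 is the
critical weight, as `x² - x + 1/4 = (x - 1/2)²`, so each step at most halves `P`. The fork of type D
costs one more factor of 2. -/

theorem dynkinGraph_A_adj_iff {n : ℕ} {i j : Fin n} (h : i < j) :
    (A.dynkinGraph n).Adj i j ↔ i.val + 1 = j.val := by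
  have hij : i.val < j.val := h
  simp only [dynkinGraph, SimpleGraph.fromRel_adj, cartan, CartanMatrix.A, Matrix.of_apply,
    Fin.ext_iff, ne_eq]
  grind

theorem dynkinGraph_B_adj_iff {n : ℕ} {i j : Fin n} (h : i < j) :
    (B.dynkinGraph n).Adj i j ↔ i.val + 1 = j.val := by
  have hij : i.val < j.val := h
  simp only [dynkinGraph, SimpleGraph.fromRel_adj, cartan, CartanMatrix.B, Matrix.of_apply,
    Fin.ext_iff, ne_eq]
  grind

theorem dynkinGraph_C_adj_iff {n : ℕ} {i j : Fin n} (h : i < j) :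
    (C.dynkinGraph n).Adj i j ↔ i.val + 1 = j.val := by
  have hij : i.val < j.val := h
  simp only [dynkinGraph, SimpleGraph.fromRel_adj, cartan, CartanMatrix.C, Matrix.of_apply,
    Fin.ext_iff, ne_eq]
  grind

/-- Vertices are numbered from 0: all but the last form a path, and the last hangs on `n - 3`. For
`n = 2` there is no edge. -/
theorem dynkinGraph_D_adj_iff {n : ℕ} {i j : Fin n} (h : i < j) :
    (D.dynkinGraph n).Adj i j ↔
      (i.val + 1 = j.val ∧ j.val + 1 < n) ∨ (i.val + 3 = n ∧ j.val + 1 = n) := by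
  have hij : i.val < j.val := h
  have hj := j.isLt
  simp only [dynkinGraph, SimpleGraph.fromRel_adj, cartan, CartanMatrix.D, Matrix.of_apply,
    Fin.ext_iff, ne_eq]
  grind

/-! ### Products of matrix units -/

section unitMatrix

variable {K : Type*} [Field K] {N : ℕ}

theorem unitMatrix_mul_of_ne {i j k l : ℕ} (h : j ≠ k) :
    unitMatrix K N i j * unitMatrix K N k l = 0 := by
  ext a b
  simp only [unitMatrix, Matrix.mul_apply, Matrix.of_apply, Matrix.zero_apply]
  refine Finset.sum_eq_zero fun x _ => ?_
  split_ifs <;> grind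

theorem unitMatrix_mul_of_eq {i j k l : ℕ} (h : j = k) (hj : 1 ≤ j) (hN : j ≤ N) :
    unitMatrix K N i j * unitMatrix K N k l = unitMatrix K N i l := by
  subst h
  ext a b
  simp only [unitMatrix, Matrix.mul_apply, Matrix.of_apply]
  rw [Finset.sum_eq_single (⟨j - 1, by omega⟩ : Fin N)]
  · split_ifs <;> grind
  · intro x _ hx
    have : x.val + 1 ≠ j := fun h => hx (Fin.ext (by simp; omega))
    simp [this]
  · simp

theorem unitMatrix_ne_zero {i j : ℕ} (hi : 1 ≤ i) (hiN : i ≤ N) (hj : 1 ≤ j) (hjN : j ≤ N) :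
    unitMatrix K N i j ≠ 0 := fun h => by
  have := congrFun (congrFun h ⟨i - 1, by omega⟩) ⟨j - 1, by omega⟩
  simp only [unitMatrix, Matrix.of_apply, Matrix.zero_apply] at this
  rw [if_pos (by omega)] at this
  exact one_ne_zero this

end unitMatrix

theorem commute_one_add_iff {R : Type*} [Ring R] {x y : R} :
    Commute (1 + x) (1 + y) ↔ x * y = y * x := by
  simp only [commute_iff_eq, mul_add, add_mul, one_mul, mul_one]
  constructor
  · intro h
    have := congrArg (fun z => z - 1 - x - y) h
    convert this using 1 <;> abel
  · intro h
    rw [h]; abel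

/-! ### Commuting root subgroups -/

variable {X : ClassicalType} {n : ℕ} {K : Type*} [Field K]

theorem rootSubgroupsCommute_iff {i j : Fin n} : X.RootSubgroupsCommute n K i j ↔
    ∀ c d : K, Commute (X.epsilon n K (i.val + 1) c) (X.epsilon n K (j.val + 1) d) := by
  simp [RootSubgroupsCommute, simpleRootSubgroup]

theorem RootSubgroupsCommute.symm {i j : Fin n} (h : X.RootSubgroupsCommute n K i j) :
    X.RootSubgroupsCommute n K j i :=
  fun x hx y hy => (h y hy x hx).symm

theorem epsilon_commute_self (k : ℕ) (c d : K) :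
    Commute (X.epsilon n K k c) (X.epsilon n K k d) := by
  have key : ∀ {R : Type _} [Ring R] [Algebra K R] (x : R),
      Commute (1 + c • x) (1 + d • x) := fun x => by
    rw [commute_one_add_iff]
    simp only [smul_mul_smul_comm, mul_comm c d]
  cases X with
  | A => exact key _
  | B =>
    simp only [epsilon]
    split_ifs
    · exact key _
    · rw [add_sub_assoc, add_sub_assoc, commute_one_add_iff]
      simp (disch := omega) only [mul_sub, sub_mul, smul_mul_smul_comm, unitMatrix_mul_of_ne,
        mul_comm c d, smul_zero, sub_zero, zero_sub]
  | C =>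
    simp only [epsilon]
    split_ifs <;> exact key _
  | D =>
    simp only [epsilon]
    split_ifs <;> exact key _

theorem rootSubgroupsCommute_self (i : Fin n) : X.RootSubgroupsCommute n K i i :=
  rootSubgroupsCommute_iff.2 fun c d => epsilon_commute_self _ c d

theorem rootSubgroupsCommute_A_iff {i j : Fin n} (h : i < j) :
    A.RootSubgroupsCommute n K i j ↔
      i.val + 1 ≠ j.val := by
  have hij : i.val < j.val := h
  have hj := j.isLt
  have hi : i.val + 1 < n := by omega
  rw [rootSubgroupsCommute_iff]
  simp only [epsilon, commute_one_add_iff]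
  constructor
  · intro H hE
    -- In row `i + 1` only one of the two products is nonzero.
    have H := congrArg (unitMatrix K _ (i.val + 1) (i.val + 1) * ·) (H 1 1)
    simp (disch := first | omega | (dsimp only [dim]; omega)) only [unitMatrix_mul_of_ne,
      unitMatrix_mul_of_eq, mul_one, one_smul, mul_sub, sub_mul, mul_add, add_mul, smul_mul_assoc,
      mul_smul_comm, smul_zero, sub_zero, mul_zero, zero_sub, add_zero, one_pow,
  neg_zero, mul_neg, neg_mul, zero_mul] at H
    refine unitMatrix_ne_zero ?_ ?_ ?_ ?_ H <;> first | omega | (dsimp only [dim]; omega)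
  · intro hE c d
    simp (disch := omega) only [unitMatrix_mul_of_ne, smul_mul_assoc, mul_smul_comm, mul_sub,
      sub_mul, mul_add, add_mul, smul_zero, sub_zero, add_zero, zero_sub, neg_zero]

theorem rootSubgroupsCommute_B_iff {i j : Fin n} (h : i < j) :
    B.RootSubgroupsCommute n K i j ↔
      i.val + 1 ≠ j.val := by
  have hij : i.val < j.val := h
  have hj := j.isLt
  have hi : i.val + 1 < n := by omega
  rw [rootSubgroupsCommute_iff]
  by_cases hjn : j.val + 1 < n
  · simp only [epsilon, hi, hjn, if_true, commute_one_add_iff]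
    constructor
    · intro H hE
      have H := congrArg (unitMatrix K _ (i.val + 1) (i.val + 1) * ·) (H 1 1)
      simp (disch := first | omega | (dsimp only [dim]; omega)) only [unitMatrix_mul_of_ne,
        unitMatrix_mul_of_eq, mul_one, one_smul, mul_sub, sub_mul, mul_add, add_mul, smul_mul_assoc,
        mul_smul_comm, smul_zero, sub_zero, mul_zero, zero_sub, add_zero, one_pow,
  neg_zero, mul_neg, neg_mul, zero_mul] at H
      refine unitMatrix_ne_zero ?_ ?_ ?_ ?_ H <;> first | omega | (dsimp only [dim]; omega)
    · intro hE c d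
      simp (disch := omega) only [unitMatrix_mul_of_ne, smul_mul_assoc, mul_smul_comm, mul_sub,
        sub_mul, mul_add, add_mul, smul_zero, sub_zero, add_zero, zero_sub, neg_zero]
  · simp only [epsilon, hi, hjn, if_true, if_false, add_sub_assoc, commute_one_add_iff]
    constructor
    · intro H hE
      -- The quadratic term of `ε_n` adds a second entry to this row; column `n + 1` discards it.
      have H := congrArg (fun x => unitMatrix K _ (i.val + 1) (i.val + 1) * x *
        unitMatrix K _ (n + 1) (n + 1)) (H 1 1)
      simp (disch := first | omega | (dsimp only [dim]; omega)) only [unitMatrix_mul_of_ne,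
        unitMatrix_mul_of_eq, mul_one, one_smul, mul_sub, sub_mul, mul_add, add_mul, smul_mul_assoc,
        mul_smul_comm, smul_zero, sub_zero, mul_zero, zero_sub, add_zero, one_pow,
  neg_zero, mul_neg, neg_mul, zero_mul] at H
      refine unitMatrix_ne_zero ?_ ?_ ?_ ?_ H <;> first | omega | (dsimp only [dim]; omega)
    · intro hE c d
      simp (disch := omega) only [unitMatrix_mul_of_ne, smul_mul_assoc, mul_smul_comm, mul_sub,
        sub_mul, mul_add, add_mul, smul_zero, sub_zero, add_zero, zero_sub, neg_zero]

theorem rootSubgroupsCommute_C_iff {i j : Fin n} (hK : (2 : K) ≠ 0) (h : i < j) :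
    C.RootSubgroupsCommute n K i j ↔
      i.val + 1 ≠ j.val := by
  have hij : i.val < j.val := h
  have hj := j.isLt
  have hi : i.val + 1 < n := by omega
  rw [rootSubgroupsCommute_iff]
  by_cases hjn : j.val + 1 < n
  · simp only [epsilon, hi, hjn, if_true, commute_one_add_iff]
    constructor
    · intro H hE
      have H := congrArg (unitMatrix K _ (i.val + 1) (i.val + 1) * ·) (H 1 1)
      simp (disch := first | omega | (dsimp only [dim]; omega)) only [unitMatrix_mul_of_ne,
        unitMatrix_mul_of_eq, mul_one, one_smul, mul_sub, sub_mul, mul_add, add_mul, smul_mul_assoc,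
        mul_smul_comm, smul_zero, sub_zero, mul_zero, zero_sub, add_zero, one_pow,
  neg_zero, mul_neg, neg_mul, zero_mul] at H
      refine unitMatrix_ne_zero ?_ ?_ ?_ ?_ H <;> first | omega | (dsimp only [dim]; omega)
    · intro hE c d
      simp (disch := omega) only [unitMatrix_mul_of_ne, smul_mul_assoc, mul_smul_comm, mul_sub,
        sub_mul, mul_add, add_mul, smul_zero, sub_zero, add_zero, zero_sub, neg_zero]
  · simp only [epsilon, hi, hjn, if_true, if_false, commute_one_add_iff]
    constructor
    · intro H hE
      have H := congrArg (unitMatrix K _ (i.val + 1) (i.val + 1) * ·) (H 1 1)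
      simp (disch := first | omega | (dsimp only [dim]; omega)) only [unitMatrix_mul_of_ne,
        unitMatrix_mul_of_eq, mul_one, one_smul, mul_sub, sub_mul, mul_add, add_mul, smul_mul_assoc,
        mul_smul_comm, smul_zero, sub_zero, mul_zero, zero_sub, add_zero, one_pow,
  neg_zero, mul_neg, neg_mul, zero_mul] at H
      -- The characteristic matters only here: `1 + 2cE` is trivial when `2 = 0`.
      rw [← two_smul K] at H
      refine smul_ne_zero hK (unitMatrix_ne_zero ?_ ?_ ?_ ?_) H <;>
        first | omega | (dsimp only [dim]; omega)
    · intro hE c d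
      simp (disch := omega) only [unitMatrix_mul_of_ne, smul_mul_assoc, mul_smul_comm, mul_sub,
        sub_mul, mul_add, add_mul, smul_zero, sub_zero, add_zero, zero_sub, neg_zero]

theorem rootSubgroupsCommute_D_iff {i j : Fin n} (h : i < j) :
    D.RootSubgroupsCommute n K i j ↔
      ¬ ((i.val + 1 = j.val ∧ j.val + 1 < n) ∨ (i.val + 3 = n ∧ j.val + 1 = n)) := by
  have hij : i.val < j.val := h
  have hj := j.isLt
  have hi : i.val + 1 < n := by omega
  rw [rootSubgroupsCommute_iff]
  by_cases hjn : j.val + 1 < n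
  · simp only [epsilon, hi, hjn, if_true, commute_one_add_iff]
    constructor
    · rintro H (hE | hE)
      have H := congrArg (unitMatrix K _ (i.val + 1) (i.val + 1) * ·) (H 1 1)
      simp (disch := first | omega | (dsimp only [dim]; omega)) only [unitMatrix_mul_of_ne,
        unitMatrix_mul_of_eq, mul_one, one_smul, mul_sub, sub_mul, mul_add, add_mul, smul_mul_assoc,
        mul_smul_comm, smul_zero, sub_zero, mul_zero, zero_sub, add_zero, one_pow,
  neg_zero, mul_neg, neg_mul, zero_mul] at H
      refine unitMatrix_ne_zero ?_ ?_ ?_ ?_ H <;> first | omega | (dsimp only [dim]; omega)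
      · omega
    · intro hE c d
      have hE : i.val + 1 ≠ j.val := fun h => hE (Or.inl ⟨h, trivial⟩)
      simp (disch := omega) only [unitMatrix_mul_of_ne, smul_mul_assoc, mul_smul_comm, mul_sub,
        sub_mul, mul_add, add_mul, smul_zero, sub_zero, add_zero, zero_sub, neg_zero]
  · simp only [epsilon, hi, hjn, if_true, if_false, commute_one_add_iff]
    constructor
    · rintro H (hE | hE)
      · exact hE.2.elim
      have H := congrArg (unitMatrix K _ (i.val + 1) (i.val + 1) * ·) (H 1 1)
      simp (disch := first | omega | (dsimp only [dim]; omega)) only [unitMatrix_mul_of_ne,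
        unitMatrix_mul_of_eq, mul_one, one_smul, mul_sub, sub_mul, mul_add, add_mul, smul_mul_assoc,
        mul_smul_comm, smul_zero, sub_zero, mul_zero, zero_sub, add_zero, one_pow,
  neg_zero, mul_neg, neg_mul, zero_mul] at H
      refine unitMatrix_ne_zero ?_ ?_ ?_ ?_ H <;> first | omega | (dsimp only [dim]; omega)
    · intro hE c d
      have hE : i.val + 3 ≠ n := fun h => hE (Or.inr ⟨h, by omega⟩)
      -- For the two tips of the fork the products do not vanish: both orders give the same multiple
      -- of `E (n - 1) (n + 2)`.
      by_cases hin : i.val + 2 = n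
      · have h₁ : 2 * n + 1 - (i.val + 1) = n + 2 := by omega
        have h₂ : n - 1 = i.val + 1 := by omega
        simp (disch := first | omega | (dsimp only [dim]; omega)) only
          [unitMatrix_mul_of_ne, unitMatrix_mul_of_eq, smul_mul_assoc, mul_smul_comm, mul_sub,
          sub_mul, h₁, h₂]
        simp only [sub_zero, smul_zero, zero_sub, smul_neg, smul_comm c d]
      simp (disch := omega) only [unitMatrix_mul_of_ne, smul_mul_assoc, mul_smul_comm, mul_sub,
        sub_mul, mul_add, add_mul, smul_zero, sub_zero, add_zero, zero_sub, neg_zero]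

theorem rootSubgroupsCommute_iff_not_adj (hK : (2 : K) ≠ 0) (i j : Fin n) :
    X.RootSubgroupsCommute n K i j ↔ ¬ (X.dynkinGraph n).Adj i j := by
  have key : ∀ i j : Fin n, i < j →
      (X.RootSubgroupsCommute n K i j ↔ ¬ (X.dynkinGraph n).Adj i j) := fun i j h => by
    cases X with
    | A => rw [rootSubgroupsCommute_A_iff h, dynkinGraph_A_adj_iff h]
    | B => rw [rootSubgroupsCommute_B_iff h, dynkinGraph_B_adj_iff h]
    | C => rw [rootSubgroupsCommute_C_iff hK h, dynkinGraph_C_adj_iff h]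
    | D => rw [rootSubgroupsCommute_D_iff h, dynkinGraph_D_adj_iff h]
  rcases lt_trichotomy i j with h | rfl | h
  · exact key i j h
  · simpa using rootSubgroupsCommute_self i
  · rw [(X.dynkinGraph n).adj_comm, ← key j i h]
    exact ⟨RootSubgroupsCommute.symm, RootSubgroupsCommute.symm⟩

end ClassicalType
/-! ### Words -/

section words

variable {G : Type*} [Group G] {S : Set G}

theorem mul_mem_wordSet_succ {m : ℕ} {s g : G} (hs : s ∈ S) (hg : g ∈ wordSet S m) :
    s * g ∈ wordSet S (m + 1) := by
  obtain ⟨w, hw, hS, rfl⟩ := hg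
  exact ⟨s :: w, by simp [hw], by simpa [hs] using hS, by simp⟩

theorem exists_of_mem_wordSet_succ {m : ℕ} {g : G} (hg : g ∈ wordSet S (m + 1)) :
    ∃ s ∈ S, s⁻¹ * g ∈ wordSet S m := by
  obtain ⟨w, hw, hS, rfl⟩ := hg
  obtain ⟨s, w, rfl⟩ := List.exists_cons_of_length_eq_add_one hw
  exact ⟨s, hS s (by simp), w, by simpa using hw, fun x hx => hS x (by simp [hx]), by simp⟩

theorem wordSet_zero : wordSet S 0 = {1} := by
  ext g
  constructor
  · rintro ⟨w, hw, -, rfl⟩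
    simp [List.length_eq_zero_iff.1 hw]
  · rintro rfl
    exact ⟨[], rfl, by simp, rfl⟩

end words

/-! ### Clique polynomials -/

section cliqueSum

open Finset

open scoped Classical in
/-- The value at `-t` of the clique polynomial of the relation `r` on the finite set `A`. -/
noncomputable def cliqueSum {ι : Type*} (r : ι → ι → Prop) (t : ℝ) (A : Finset ι) : ℝ :=
  ∑ T ∈ A.powerset, if (T : Set ι).Pairwise r then (-t) ^ #T else 0

variable {ι : Type*} {r : ι → ι → Prop} {t : ℝ}

theorem cliqueSum_empty : cliqueSum r t ∅ = 1 := by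
  simp [cliqueSum]

/-- A clique containing `b` is `b` together with a clique among the elements of `A` related to `b`.
-/
theorem cliqueSum_insert [DecidableEq ι] [DecidableRel r] [Std.Symm r] {b : ι} {A : Finset ι}
    (hb : b ∉ A) :
    cliqueSum r t (insert b A) = cliqueSum r t A - t * cliqueSum r t {a ∈ A | r b a} := by
  have h : {a ∈ A | r b a}.powerset = {T ∈ A.powerset | ∀ a ∈ T, r b a} := by
    ext T
    simp only [mem_powerset, mem_filter, subset_iff]
    grind
  rw [cliqueSum, sum_powerset_insert hb, cliqueSum, sub_eq_add_neg, cliqueSum, h, sum_filter,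
    mul_sum, ← sum_neg_distrib]
  congr 1
  refine sum_congr rfl fun T hT => ?_
  have hbT : b ∉ T := fun h => hb (mem_powerset.1 hT h)
  simp only [coe_insert, Set.pairwise_insert_of_symm_of_notMem (show b ∉ (T : Set ι) by simpa),
    card_insert_of_notMem hbT, pow_succ', mem_coe]
  split_ifs <;> first | tauto | ring

theorem cliqueSum_le_of_subset [Std.Symm r] (ht : 0 ≤ t) (h0 : ∀ A, 0 ≤ cliqueSum r t A)
    {A B : Finset ι} (h : A ⊆ B) : cliqueSum r t B ≤ cliqueSum r t A := by
  classical
  suffices ∀ C, cliqueSum r t (A ∪ C) ≤ cliqueSum r t A by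
    simpa [union_eq_right.2 h] using this B
  intro C
  induction C using Finset.induction_on with
  | empty => simp
  | insert b C _ ih =>
    by_cases hb : b ∈ A ∪ C
    · rwa [union_insert, insert_eq_of_mem hb]
    · rw [union_insert, cliqueSum_insert hb]
      linarith [mul_nonneg ht (h0 {a ∈ A ∪ C | r b a})]

/-- Telescoping: adjoin the elements of `s \ A` to `A` in increasing order; each summand is the drop
given by `cliqueSum_insert`. -/
theorem sum_cliqueSum_eq_sub [LinearOrder ι] [DecidableRel r] [Std.Symm r] (A s : Finset ι) :
    ∑ b ∈ s \ A, t * cliqueSum r t {a ∈ A ∪ {x ∈ s | x < b} | r b a} =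
      cliqueSum r t A - cliqueSum r t (A ∪ s) := by
  induction s using Finset.induction_on_max with
  | empty => simp
  | insert a s hs ih =>
    have has : a ∉ s := fun h => lt_irrefl _ (hs a h)
    have h₁ : ∀ b ∈ s \ A, {x ∈ insert a s | x < b} = {x ∈ s | x < b} := fun b hb => by
      rw [filter_insert, if_neg (hs b (mem_sdiff.1 hb).1).not_gt]
    have h₂ : {x ∈ insert a s | x < a} = s := by
      rw [filter_insert, if_neg (lt_irrefl a), filter_true_of_mem hs]
    by_cases haA : a ∈ A
    · rw [insert_sdiff_of_mem _ haA, union_insert, insert_eq_of_mem (mem_union_left _ haA), ← ih]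
      exact sum_congr rfl fun b hb => by rw [h₁ b hb]
    · rw [insert_sdiff_of_notMem _ haA, sum_insert (by simp [has]), h₂, union_insert,
        cliqueSum_insert (by simp [has, haA]), sum_congr rfl fun b hb => by rw [h₁ b hb], ih]
      ring

end cliqueSum

/-! ### Growth of groups with commuting generators -/

section growth

open Finset

variable {G ι : Type*} [Group G] {f : ι → G} {r : ι → ι → Prop} {t : ℝ}

/-- The products of `m` generators that cannot begin with a generator whose index lies in `A`. -/
def avoidingSet (f : ι → G) (A : Finset ι) (m : ℕ) : Set G :=
  {g | g ∈ wordSet (Set.range f) m ∧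
    ∀ a ∈ A, ∀ k, m = k + 1 → (f a)⁻¹ * g ∉ wordSet (Set.range f) k}

theorem avoidingSet_empty (m : ℕ) : avoidingSet f ∅ m = wordSet (Set.range f) m := by
  simp [avoidingSet]

theorem avoidingSet_finite [Finite ι] (A : Finset ι) (m : ℕ) : (avoidingSet f A m).Finite :=
  (wordSet_finite (Set.finite_range f) m).subset fun _ h => h.1

/-- Strip the least possible first letter `b`. If the rest could begin with some `a` commuting with
`b`, then `a` could be moved to the front, so `a` is neither in `A` nor below `b`. -/
theorem avoidingSet_succ_subset [LinearOrder ι] [Fintype ι] [DecidableRel r]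
    (hf : ∀ a b, r a b → Commute (f a) (f b)) (A : Finset ι) (m : ℕ) :
    avoidingSet f A (m + 1) ⊆ ⋃ b ∈ univ \ A,
      (f b * ·) '' avoidingSet f {a ∈ A ∪ {x ∈ (univ : Finset ι) | x < b} | r b a} m := by
  rintro g ⟨hg, hA⟩
  have hne : {b | (f b)⁻¹ * g ∈ wordSet (Set.range f) m}.Nonempty := by
    obtain ⟨_, ⟨b, rfl⟩, hb⟩ := exists_of_mem_wordSet_succ hg
    exact ⟨b, hb⟩
  obtain ⟨b, hb, hmin⟩ := WellFounded.has_min (wellFounded_lt (α := ι)) _ hne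
  simp only [Set.mem_iUnion, Set.mem_image]
  refine ⟨b, by simpa using fun h => hA b h m rfl hb, (f b)⁻¹ * g, ⟨hb, ?_⟩, by simp⟩
  rintro a ha k rfl hk
  have hab : (f a)⁻¹ * g ∈ wordSet (Set.range f) (k + 1) := by
    convert mul_mem_wordSet_succ (Set.mem_range_self b) hk using 1
    have := (hf b a (mem_filter.1 ha).2).inv_right.eq
    rw [← mul_assoc, this]
    group
  rcases mem_union.1 (mem_filter.1 ha).1 with h | h
  · exact hA a h _ rfl hab
  · exact hmin a hab (mem_filter.1 h).2

/-- The bound for general `A` makes the induction close: the bounds for the possible first letters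
telescope to `cliqueSum r t A - cliqueSum r t univ`. -/
theorem ncard_avoidingSet_mul_le [LinearOrder ι] [Fintype ι] [Std.Symm r]
    (hf : ∀ a b, r a b → Commute (f a) (f b)) (ht : 0 ≤ t) (h0 : ∀ A, 0 ≤ cliqueSum r t A)
    (m : ℕ) (A : Finset ι) :
    (avoidingSet f A m).ncard * (t ^ m * cliqueSum r t univ) ≤ cliqueSum r t A := by
  classical
  induction m generalizing A with
  | zero =>
    have h : (avoidingSet f A 0).ncard ≤ 1 := by
      rw [← Set.ncard_singleton (1 : G), ← wordSet_zero (S := Set.range f)]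
      exact Set.ncard_le_ncard (fun _ h => h.1) (wordSet_finite (Set.finite_range f) 0)
    have h' : ((avoidingSet f A 0).ncard : ℝ) ≤ 1 := by exact_mod_cast h
    rw [pow_zero, one_mul]
    exact (mul_le_of_le_one_left (h0 _) h').trans
      (cliqueSum_le_of_subset ht h0 (subset_univ _))
  | succ m ih =>
    have hcard : (avoidingSet f A (m + 1)).ncard ≤ ∑ b ∈ univ \ A,
        (avoidingSet f {a ∈ A ∪ {x ∈ (univ : Finset ι) | x < b} | r b a} m).ncard := by
      refine (Set.ncard_le_ncard (avoidingSet_succ_subset hf A m) ?_).trans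
        ((Finset.set_ncard_biUnion_le _ _).trans (sum_le_sum fun b _ => ?_))
      · exact (finite_toSet _).biUnion fun b _ => (avoidingSet_finite _ m).image _
      · exact Set.ncard_image_le (avoidingSet_finite _ m)
    have hcard' : ((avoidingSet f A (m + 1)).ncard : ℝ) ≤ ∑ b ∈ univ \ A,
        ((avoidingSet f {a ∈ A ∪ {x ∈ (univ : Finset ι) | x < b} | r b a} m).ncard : ℝ) := by
      exact_mod_cast hcard
    calc ((avoidingSet f A (m + 1)).ncard : ℝ) * (t ^ (m + 1) * cliqueSum r t univ)
        ≤ (∑ b ∈ univ \ A, ((avoidingSet f {a ∈ A ∪ {x ∈ (univ : Finset ι) | x < b} | r b a} m).ncard :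
            ℝ)) * (t ^ (m + 1) * cliqueSum r t univ) :=
          mul_le_mul_of_nonneg_right hcard' (mul_nonneg (pow_nonneg ht _) (h0 _))
      _ = ∑ b ∈ univ \ A, t * (((avoidingSet f {a ∈ A ∪ {x ∈ (univ : Finset ι) | x < b} | r b a} m).ncard :
            ℝ) * (t ^ m * cliqueSum r t univ)) := by
          rw [sum_mul]
          exact sum_congr rfl fun b _ => by ring
      _ ≤ ∑ b ∈ univ \ A, t * cliqueSum r t {a ∈ A ∪ {x ∈ (univ : Finset ι) | x < b} | r b a} :=
          sum_le_sum fun b _ => mul_le_mul_of_nonneg_left (ih _) ht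
      _ = cliqueSum r t A - cliqueSum r t univ := by
          rw [sum_cliqueSum_eq_sub, union_eq_right.2 (subset_univ A)]
      _ ≤ cliqueSum r t A := sub_le_self _ (h0 _)

/-- If the generators commute according to `r`, then the growth series of the monoid they generate
is at most the inverse of the clique polynomial of `r`. -/
theorem wordGrowth_range_mul_le [Fintype ι] [Std.Symm r]
    (hf : ∀ a b, r a b → Commute (f a) (f b)) (ht : 0 ≤ t) (h0 : ∀ A, 0 ≤ cliqueSum r t A)
    (m : ℕ) :
    wordGrowth (Set.range f) m * (t ^ m * cliqueSum r t univ) ≤ 1 := by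
  -- Any linear order serves to choose first letters.
  let : LinearOrder ι := LinearOrder.lift' (Fintype.equivFin ι) (Fintype.equivFin ι).injective
  have := ncard_avoidingSet_mul_le hf ht h0 m ∅
  rwa [avoidingSet_empty, cliqueSum_empty] at this

end growth
/-! ### Clique polynomials of blown-up complements of graphs -/

section blowup

open Finset

variable {ι V : Type*} (Γ : SimpleGraph V) (π : ι → V) (t : ℝ)

instance symm_not_adj_comp : Std.Symm fun a b => ¬ Γ.Adj (π a) (π b) :=
  ⟨fun _ _ h h' => h h'.symm⟩

/-- The points of `C` are pairwise related and have the same related points in `B`. The nonempty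
subsets of `C` therefore contribute the common factor `(1 - t) ^ #C - 1`. -/
theorem cliqueSum_union_fiber [DecidableEq ι] [DecidableRel Γ.Adj] {v : V} {B C : Finset ι}
    (hB : ∀ b ∈ B, π b ≠ v) (hC : ∀ c ∈ C, π c = v) :
    cliqueSum (fun a b => ¬ Γ.Adj (π a) (π b)) t (B ∪ C) =
      cliqueSum (fun a b => ¬ Γ.Adj (π a) (π b)) t B -
        (1 - (1 - t) ^ #C) *
          cliqueSum (fun a b => ¬ Γ.Adj (π a) (π b)) t {b ∈ B | ¬ Γ.Adj v (π b)} := by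
  induction C using Finset.induction_on generalizing B with
  | empty => simp
  | insert c C hc ih =>
    have hcv : π c = v := hC c (mem_insert_self c C)
    have hC' : ∀ c ∈ C, π c = v := fun x hx => hC x (mem_insert_of_mem hx)
    have hcB : c ∉ B := fun h => hB c h hcv
    have h₁ : {b ∈ B ∪ C | ¬ Γ.Adj (π c) (π b)} = {b ∈ B | ¬ Γ.Adj v (π b)} ∪ C := by
      rw [filter_union, hcv, filter_true_of_mem (s := C) fun b hb => by simp [hC' b hb]]
    rw [union_insert, cliqueSum_insert (by simp [hc, hcB]), h₁, ih hB hC',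
      ih (fun b hb => hB b (mem_filter.1 hb).1) hC', filter_filter, card_insert_of_notMem hc]
    simp only [and_self]
    ring

/-- The clique polynomial of the part of `A` that lies over the vertex set `U`. -/
noncomputable def fiberSum [DecidableEq V] (A : Finset ι) (U : Finset V) : ℝ :=
  cliqueSum (fun a b => ¬ Γ.Adj (π a) (π b)) t {a ∈ A | π a ∈ U}

variable [DecidableEq V] {A : Finset ι}

theorem fiberSum_empty : fiberSum Γ π t A ∅ = 1 := by
  simp [fiberSum, cliqueSum_empty]

theorem fiberSum_univ [Fintype V] :
    fiberSum Γ π t A univ = cliqueSum (fun a b => ¬ Γ.Adj (π a) (π b)) t A := by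
  simp [fiberSum]

theorem fiberSum_insert [DecidableEq ι] [DecidableRel Γ.Adj] {v : V} {U : Finset V} (hv : v ∉ U) :
    fiberSum Γ π t A (insert v U) = fiberSum Γ π t A U -
      (1 - (1 - t) ^ #{a ∈ A | π a = v}) * fiberSum Γ π t A {u ∈ U | ¬ Γ.Adj v u} := by
  have h : {a ∈ A | π a ∈ insert v U} = {a ∈ A | π a ∈ U} ∪ {a ∈ A | π a = v} := by
    rw [← filter_or]
    exact filter_congr fun a _ => by rw [mem_insert, or_comm]
  have h' : {a ∈ A | π a ∈ ({u ∈ U | ¬ Γ.Adj v u} : Finset V)} =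
      {b ∈ ({a ∈ A | π a ∈ U} : Finset ι) | ¬ Γ.Adj v (π b)} := by
    rw [filter_filter]
    exact filter_congr fun a _ => by rw [mem_filter]
  rw [fiberSum, h, cliqueSum_union_fiber Γ π t (v := v), fiberSum, fiberSum, h']
  · rintro b hb rfl
    exact hv (mem_filter.1 hb).2
  · exact fun c hc => (mem_filter.1 hc).2

end blowup

/-! ### Lower bounds for independence polynomials of Dynkin diagrams -/

section recursion

open Finset

/-- If `P k ≤ 2 * P (k + 1)`, then subtracting at most `P k / 4` removes at most half of `P (k +
1)`. At `k = 0` truncated subtraction gives `P 1 = (1 - w 0) * P 0`, as it should for a single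
vertex. -/
theorem half_le_succ_of_recursion {N : ℕ} {P w : ℕ → ℝ} (hw : ∀ k, w k ≤ 1 / 4) (h0 : P 0 = 1)
    (hP : ∀ k < N, P (k + 1) = P k - w k * P (k - 1)) (k : ℕ) (hk : k ≤ N) :
    0 < P k ∧ (k < N → P k / 2 ≤ P (k + 1)) := by
  induction k with
  | zero =>
    refine ⟨by simp [h0], fun h => ?_⟩
    rw [hP 0 h]
    simp only [zero_tsub, h0]
    linarith [hw 0]
  | succ k ih =>
    obtain ⟨h₁, h₂⟩ := ih (by omega)
    have h₂ := h₂ (by omega)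
    refine ⟨by linarith, fun h => ?_⟩
    rw [hP _ h, Nat.add_sub_cancel]
    nlinarith [mul_le_mul_of_nonneg_right (hw (k + 1)) h₁.le]

theorem half_pow_le_of_recursion {N : ℕ} {P w : ℕ → ℝ} (hw : ∀ k, w k ≤ 1 / 4) (h0 : P 0 = 1)
    (hP : ∀ k < N, P (k + 1) = P k - w k * P (k - 1)) (k : ℕ) (hk : k ≤ N) :
    (1 / 2) ^ k ≤ P k := by
  induction k with
  | zero => simp [h0]
  | succ k ih =>
    have := (half_le_succ_of_recursion hw h0 hP k (by omega)).2 (by omega)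
    rw [pow_succ]
    linarith [ih (by omega)]

variable {n : ℕ} {Γ : SimpleGraph (Fin n)} [DecidableRel Γ.Adj] {F : Finset (Fin n) → ℝ}
  {w : Fin n → ℝ}

/-- Vertex `k` has no earlier neighbour but `k - 1`. Allowing `N < n` covers the path inside type D;
the default weight 0 is never reached for `k < N`. -/
theorem initial_recursion {N : ℕ} (hN : N ≤ n)
    (hΓ : ∀ i j : Fin n, i < j → j.val < N → (Γ.Adj i j ↔ i.val + 1 = j.val))
    (hF : ∀ v U, v ∉ U → F (insert v U) = F U - w v * F {u ∈ U | ¬ Γ.Adj v u})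
    (k : ℕ) (hk : k < N) :
    F {i | i.val < k + 1} = F {i | i.val < k} -
      (if h : k < n then w ⟨k, h⟩ else 0) * F {i | i.val < k - 1} := by
  have hkn : k < n := by omega
  have h₁ : ({i | i.val < k + 1} : Finset (Fin n)) =
      insert ⟨k, hkn⟩ ({i | i.val < k} : Finset (Fin n)) := by
    ext i
    simp only [mem_filter, mem_univ, true_and, mem_insert, Fin.ext_iff]
    omega
  have h₂ : ({u ∈ ({i | i.val < k} : Finset (Fin n)) | ¬ Γ.Adj ⟨k, hkn⟩ u} : Finset (Fin n)) =
      ({i | i.val < k - 1} : Finset (Fin n)) := by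
    ext i
    simp only [mem_filter, mem_univ, true_and]
    constructor
    · rintro ⟨h, h'⟩
      rw [Γ.adj_comm, hΓ i ⟨k, hkn⟩ h hk] at h'
      simp only at h'
      omega
    · intro h
      have h' : i < ⟨k, hkn⟩ := by
        rw [Fin.lt_def]
        simp only
        omega
      rw [Γ.adj_comm, hΓ i ⟨k, hkn⟩ h' hk]
      simp only
      omega
  rw [h₁, hF _ _ (by simp), h₂, dif_pos hkn]

theorem half_pow_le_of_path (hw : ∀ v, w v ≤ 1 / 4) (h0 : F ∅ = 1)
    (hΓ : ∀ i j : Fin n, i < j → (Γ.Adj i j ↔ i.val + 1 = j.val))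
    (hF : ∀ v U, v ∉ U → F (insert v U) = F U - w v * F {u ∈ U | ¬ Γ.Adj v u}) :
    (1 / 2) ^ n ≤ F univ := by
  have := half_pow_le_of_recursion (P := fun k => F {i | i.val < k})
    (w := fun k => if h : k < n then w ⟨k, h⟩ else 0) (N := n)
    (fun k => by split_ifs <;> [exact hw _; norm_num]) (by simpa using h0)
    (initial_recursion le_rfl (fun i j h _ => hΓ i j h) hF) n le_rfl
  simpa using this

theorem half_pow_le_of_fork (hn : 2 ≤ n) (hw0 : ∀ v, 0 ≤ w v) (hw : ∀ v, w v ≤ 1 / 4)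
    (h0 : F ∅ = 1)
    (hΓ : ∀ i j : Fin n, i < j → (Γ.Adj i j ↔
      (i.val + 1 = j.val ∧ j.val + 1 < n) ∨ (i.val + 3 = n ∧ j.val + 1 = n)))
    (hF : ∀ v U, v ∉ U → F (insert v U) = F U - w v * F {u ∈ U | ¬ Γ.Adj v u}) :
    (1 / 2) ^ (n + 1) ≤ F univ := by
  set P : ℕ → ℝ := fun k => F {i | i.val < k} with hP
  set w' : ℕ → ℝ := fun k => if h : k < n then w ⟨k, h⟩ else 0 with hw'
  have hw'4 : ∀ k, w' k ≤ 1 / 4 := fun k => by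
    simp only [hw']; split_ifs <;> [exact hw _; norm_num]
  have hP0 : P 0 = 1 := by simpa [hP] using h0
  have hrec : ∀ k < n - 1, P (k + 1) = P k - w' k * P (k - 1) :=
    initial_recursion (by omega) (fun i j h hj => by rw [hΓ i j h]; omega) hF
  let v : Fin n := ⟨n - 1, by omega⟩
  have huniv : (univ : Finset (Fin n)) = insert v ({i | i.val < n - 1} : Finset (Fin n)) := by
    ext i
    simp only [mem_filter, mem_univ, true_and, mem_insert, Fin.ext_iff, v, true_iff]
    omega
  rw [huniv, hF _ _ (by simp [v])]
  change _ ≤ P (n - 1) - _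
  have hpow := half_pow_le_of_recursion hw'4 hP0 hrec
  -- Type `D_2` consists of two isolated vertices.
  rcases hn.eq_or_lt with rfl | hn3
  · have h : ({u ∈ ({i | i.val < 2 - 1} : Finset (Fin 2)) | ¬ Γ.Adj v u} : Finset (Fin 2)) =
        ({i | i.val < 2 - 1} : Finset (Fin 2)) := by
      refine filter_true_of_mem fun i hi => ?_
      have hi : i.val < 2 - 1 := (mem_filter.1 hi).2
      rw [Γ.adj_comm, hΓ i v hi]
      simp only [v]
      omega
    rw [h]
    change _ ≤ P 1 - w v * P 1
    have h₁ := hpow 1 (by omega)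
    nlinarith [hw v]
  · let u : Fin n := ⟨n - 2, by omega⟩
    have h : ({x ∈ ({i | i.val < n - 1} : Finset (Fin n)) | ¬ Γ.Adj v x} : Finset (Fin n)) =
        insert u ({i | i.val < n - 3} : Finset (Fin n)) := by
      ext i
      simp only [mem_filter, mem_univ, true_and, mem_insert, Fin.ext_iff]
      by_cases hi : i.val < n - 1
      · rw [Γ.adj_comm, hΓ i v hi]
        simp only [v, u]
        omega
      · simp only [u]
        omega
    have h' : ({x ∈ ({i | i.val < n - 3} : Finset (Fin n)) | ¬ Γ.Adj u x} : Finset (Fin n)) =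
        ({i | i.val < n - 3} : Finset (Fin n)) := by
      refine filter_true_of_mem fun i hi => ?_
      have hi : i.val < n - 3 := (mem_filter.1 hi).2
      have hiu : i < u := by
        rw [Fin.lt_def]
        simp only [u]
        omega
      rw [Γ.adj_comm, hΓ i u hiu]
      simp only [u]
      omega
    rw [h, hF u _ (by simp [u]; omega), h']
    change _ ≤ P (n - 1) - w v * (P (n - 3) - w u * P (n - 3))
    obtain ⟨m, rfl⟩ : ∃ m, n = m + 3 := ⟨n - 3, by omega⟩
    have hm := hpow m (by omega)
    have e₁ := hrec (m + 1) (by omega)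
    have e₂ := (half_le_succ_of_recursion hw'4 hP0 hrec m (by omega)).2 (by omega)
    have hu : w' (m + 1) = w u := dif_pos (by omega)
    rw [hu] at e₁
    change _ ≤ P (m + 1 + 1) - w v * (P m - w u * P m)
    rw [e₁, Nat.add_sub_cancel]
    have hm0 : 0 ≤ P m := le_trans (by positivity) hm
    -- Deleting both tips leaves `P (m + 1)` minus this multiple of `P m`, hence at least `(1/2 -
    -- 7/16) * P m = P m / 16`.
    have key : w u + w v * (1 - w u) ≤ 7 / 16 := by nlinarith [hw u, hw v, hw0 u, hw0 v]
    have := mul_le_mul_of_nonneg_right key hm0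
    rw [show m + 3 + 1 = m + 4 by rfl, pow_add]
    linarith

end recursion

/-! ### The growth of `Ũ` -/

open Finset in
-- All `A` are needed, since the growth bound assumes every clique sum nonnegative. A fibre of `A`
-- has at most two points, so its weight is at most `1 - (1 - t) ^ 2`.
theorem half_pow_le_cliqueSum (X : ClassicalType) {n : ℕ} (hn : X.IsRank n) {t : ℝ} (ht0 : 0 ≤ t)
    (ht1 : t ≤ 1) (ht : 1 - (1 - t) ^ 2 ≤ 1 / 4) (A : Finset (TildeGen n)) :
    (1 / 2) ^ (n + 2) ≤
      cliqueSum (fun a b => ¬ (X.dynkinGraph n).Adj (TildeGen.index a) (TildeGen.index b)) t A := by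
  classical
  rw [← fiberSum_univ]
  have hcard : ∀ v : Fin n, #{a ∈ A | TildeGen.index a = v} ≤ 2 := fun v => by
    refine (card_le_card (t := {Sum.inl v, Sum.inr v}) ?_).trans card_le_two
    rintro (a | a) ha <;> simpa [TildeGen.index] using (mem_filter.1 ha).2
  have hw0 : ∀ v : Fin n, 0 ≤ 1 - (1 - t) ^ #{a ∈ A | TildeGen.index a = v} := fun v =>
    sub_nonneg.2 (pow_le_one₀ (by linarith) (by linarith))
  have hw : ∀ v : Fin n, 1 - (1 - t) ^ #{a ∈ A | TildeGen.index a = v} ≤ 1 / 4 := fun v => by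
    linarith [pow_le_pow_of_le_one (by linarith : 0 ≤ 1 - t) (by linarith) (hcard v)]
  have h0 := fiberSum_empty (X.dynkinGraph n) TildeGen.index t (A := A)
  have hF := fun v U =>
    fiberSum_insert (X.dynkinGraph n) TildeGen.index t (A := A) (v := v) (U := U)
  have hpow : ∀ k ≤ n + 2, (1 / 2 : ℝ) ^ (n + 2) ≤ (1 / 2) ^ k := fun k hk =>
    pow_le_pow_of_le_one (by norm_num) (by norm_num) hk
  cases X with
  | A =>
    exact (hpow n (by omega)).trans
      (half_pow_le_of_path hw h0 (fun _ _ => ClassicalType.dynkinGraph_A_adj_iff) hF)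
  | B =>
    exact (hpow n (by omega)).trans
      (half_pow_le_of_path hw h0 (fun _ _ => ClassicalType.dynkinGraph_B_adj_iff) hF)
  | C =>
    exact (hpow n (by omega)).trans
      (half_pow_le_of_path hw h0 (fun _ _ => ClassicalType.dynkinGraph_C_adj_iff) hF)
  | D =>
    exact (hpow (n + 1) (by omega)).trans
      (half_pow_le_of_fork hn hw0 hw h0 (fun _ _ => ClassicalType.dynkinGraph_D_adj_iff) hF)

theorem commute_of_rootSubgroupsCommute {X : ClassicalType} {n : ℕ} {K : Type*} [Field K]
    {s t : TildeGen n} (h : X.RootSubgroupsCommute n K s.index t.index) :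
    Commute (PresentedGroup.of (rels := tildeRels X n K) s) (PresentedGroup.of t) := by
  have := PresentedGroup.one_of_mem (rels := tildeRels X n K) ⟨s, t, h, rfl⟩
  rw [← commutatorElement_eq_one_iff_commute, commutatorElement_def]
  simpa [PresentedGroup.of] using this

theorem mainTheorem2 (X : ClassicalType) (n : ℕ) (hn : X.IsRank n)
    (K : Type*) [Field K] (hK : (2 : K) ≠ 0) :
    (∀ i j : Fin n, X.RootSubgroupsCommute n K i j ↔ ¬ (X.dynkinGraph n).Adj i j) ∧
    ∀ m : ℕ, (wordGrowth (tildeSigma X n K) m : ℝ) ≤ 2 ^ (n + 2) * (4 + 2 * Real.sqrt 3) ^ m := by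
  have hiff := ClassicalType.rootSubgroupsCommute_iff_not_adj (X := X) (n := n) hK
  refine ⟨hiff, fun m => ?_⟩
  have h3 : Real.sqrt 3 ^ 2 = 3 := Real.sq_sqrt (by norm_num)
  have h3' : Real.sqrt 3 < 2 := by
    rw [Real.sqrt_lt' (by norm_num)]
    norm_num
  -- The solution in `[0, 1]` of `1 - (1 - t) ^ 2 = 1 / 4`.
  set t : ℝ := 1 - Real.sqrt 3 / 2 with ht
  have ht0 : 0 ≤ t := by linarith
  have hM := half_pow_le_cliqueSum X hn ht0 (by linarith [Real.sqrt_nonneg 3])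
    (by rw [ht]; ring_nf; rw [h3]; norm_num)
  have hinv : t * (4 + 2 * Real.sqrt 3) = 1 := by rw [ht]; ring_nf; rw [h3]; norm_num
  have hgrowth := wordGrowth_range_mul_le (f := PresentedGroup.of (rels := tildeRels X n K))
    (fun a b h => commute_of_rootSubgroupsCommute ((hiff _ _).2 h)) ht0
    (fun A => le_trans (by positivity) (hM A)) m
  have hle : (wordGrowth (tildeSigma X n K) m : ℝ) * (t ^ m * (1 / 2) ^ (n + 2)) ≤ 1 :=
    (mul_le_mul_of_nonneg_left (mul_le_mul_of_nonneg_left (hM _) (pow_nonneg ht0 m))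
      (Nat.cast_nonneg _)).trans hgrowth
  calc (wordGrowth (tildeSigma X n K) m : ℝ)
      = (wordGrowth (tildeSigma X n K) m : ℝ) * (t ^ m * (1 / 2) ^ (n + 2)) *
          (2 ^ (n + 2) * (4 + 2 * Real.sqrt 3) ^ m) := by
        have e₁ : t ^ m * (4 + 2 * Real.sqrt 3) ^ m = 1 := by rw [← mul_pow, hinv, one_pow]
        have e₂ : (1 / 2 : ℝ) ^ (n + 2) * 2 ^ (n + 2) = 1 := by rw [← mul_pow]; norm_num
        linear_combination (-(wordGrowth (tildeSigma X n K) m : ℝ)) *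
          (e₁ * ((1 / 2 : ℝ) ^ (n + 2) * 2 ^ (n + 2)) + e₂)
    _ ≤ 1 * (2 ^ (n + 2) * (4 + 2 * Real.sqrt 3) ^ m) := by gcongr
    _ = _ := one_mul _
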